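/- Let $F:\mathbb{R}^n\to 2^{\mathbb{R}^n}$ be a finitely piecewise constant subgradient (FPCS) system, i.e. $F(x)=-\partial\Phi(x)$ for all $x$, where $\Phi(x)=\max_{i\in I}(-\mu_i^Tx+b_i)$ with $I$ finite and nonempty, $\mu_i\in\mathbb{R}^n$, $b_i\in\mathbb{R}$. Let $\|\cdot\|$ be the Euclidean norm. A function $\tilde x:[0,\infty)\to\mathbb{R}^n$ is a (continuous-time) perturbed trajectory of $F$ with perturbation $U$, where $U:[0,\infty)\to\mathbb{R}^n$ is right-continuous with $U(0)=0$, if $\tilde x$ is measurable and locally integrable and there is a measurable, locally integrable $\xi:[0,\infty)\to\mathbb{R}^n$ with $\tilde x(t)=\tilde x(0)+\int_0^t\xi(\tau)\,d\tau+U(t)$ and $\xi(t)\in F(\tilde x(t))$ for all $t\ge 0$. It is an unperturbed trajectory if $U\equiv 0$. A number $C>0$ is a sensitivity constant of $F$ if $\|\tilde x(t)-x(t)\|\le C\sup_{0\le\tau\le t}\|U(\tau)\|$ (a bound in $[0,\infty]$) for all $t\ge 0$, every unperturbed trajectory $x$ and every perturbed trajectory $\tilde x$ with perturbation $U$ and $\tilde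 x(0)=x(0)$. A sequence $z:\mathbb{Z}_+\to\mathbb{R}^n$ is a discrete-time perturbed trajectory corresponding to $V:\mathbb{Z}_+\to\mathbb{R}^n$ if $z(k+1)=z(k)+\mu(k)+V(k)$ with $\mu(k)\in F(z(k))$ for all $k\in\mathbb{Z}_+$. Then $F$ has a sensitivity constant, and there is a constant $\mu_{\max}\ge 0$, depending only on $F$, such that for every sensitivity constant $C$ of $F$, every continuous-time unperturbed trajectory $x$ and every discrete-time perturbed trajectory $z$ corresponding to a perturbation $V$ with $z(0)=x(0)$, $$\|x(k)-z(k)\|\le C\Big(\mu_{\max}+\max_{0\le j<k}\Big\|\sum_{i=0}^{j}V(i)\Big\|\Big)\qquad\text{for all } k\in\mathbb{Z}_+,$$ where the maximum over the empty set (for $k=0$) is $0$. -/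

import Mathlib

open scoped ENNReal

/-- The subdifferential of `Φ` at `x`. -/
def subdifferentialAt {n : ℕ} (Φ : EuclideanSpace ℝ (Fin n) → ℝ)
    (x : EuclideanSpace ℝ (Fin n)) : Set (EuclideanSpace ℝ (Fin n)) :=
  {g | ∀ y, Φ x + inner ℝ g (y - x) ≤ Φ y}

/-- `F` is a finitely piecewise constant subgradient system: `F = -∂Φ` where
`Φ x = max_i (-μ_iᵀ x + b_i)`, with `i` ranging over a nonempty finite set. -/
def IsFPCS {n : ℕ} (F : EuclideanSpace ℝ (Fin n) → Set (EuclideanSpace ℝ (Fin n))) : Prop :=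
  ∃ (m : ℕ) (μ : Fin (m + 1) → EuclideanSpace ℝ (Fin n)) (b : Fin (m + 1) → ℝ),
    ∀ x, F x = {v | -v ∈ subdifferentialAt
      (fun y => Finset.univ.sup' Finset.univ_nonempty (fun i => -inner ℝ (μ i) y + b i)) x}

/-- `x` is a (continuous time) perturbed trajectory of the differential inclusion `ẋ ∈ F(x)`
with right-continuous cumulative perturbation `U`, where `U 0 = 0`:
`x(t) = x(0) + ∫₀ᵗ ξ(τ) dτ + U(t)` and `ξ(t) ∈ F(x(t))` for all `t ≥ 0`, for some drift `ξ`.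
Trajectory and drift are (measurable and) integrable on bounded time intervals. Only times
`t ≥ 0` matter. -/
structure IsPerturbedTrajectory {n : ℕ}
    (F : EuclideanSpace ℝ (Fin n) → Set (EuclideanSpace ℝ (Fin n)))
    (U x : ℝ → EuclideanSpace ℝ (Fin n)) : Prop where
  rightContinuous : ∀ t, 0 ≤ t → ContinuousWithinAt U (Set.Ici t) t
  zero : U 0 = 0
  integrable : ∀ t, 0 ≤ t → MeasureTheory.IntegrableOn x (Set.Icc 0 t)
  drift : ∃ ξ : ℝ → EuclideanSpace ℝ (Fin n),
    (∀ t, 0 ≤ t → MeasureTheory.IntegrableOn ξ (Set.Icc 0 t)) ∧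
    (∀ t, 0 ≤ t → x t = x 0 + (∫ τ in (0 : ℝ)..t, ξ τ) + U t) ∧
    ∀ t, 0 ≤ t → ξ t ∈ F (x t)

/-- A trajectory with perturbation identically zero. -/
def IsUnperturbedTrajectory {n : ℕ}
    (F : EuclideanSpace ℝ (Fin n) → Set (EuclideanSpace ℝ (Fin n)))
    (x : ℝ → EuclideanSpace ℝ (Fin n)) : Prop :=
  IsPerturbedTrajectory F (fun _ => 0) x

/-- `C` is a constant of bounded sensitivity of `F`: `‖x̃(t) - x(t)‖ ≤ C sup_{0 ≤ τ ≤ t} ‖U(τ)‖`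
for every unperturbed trajectory `x` and every perturbed trajectory `x̃` with the same initial
state. The supremum is taken in `[0, ∞]`, since `U` need not be bounded on `[0, t]`. -/
def IsSensitivityConstant {n : ℕ}
    (F : EuclideanSpace ℝ (Fin n) → Set (EuclideanSpace ℝ (Fin n))) (C : ℝ) : Prop :=
  0 < C ∧ ∀ x U x' : ℝ → EuclideanSpace ℝ (Fin n),
    IsUnperturbedTrajectory F x → IsPerturbedTrajectory F U x' → x' 0 = x 0 →
    ∀ t, 0 ≤ t → ‖x' t - x t‖ₑ ≤ ENNReal.ofReal C * ⨆ τ ∈ Set.Icc (0 : ℝ) t, ‖U τ‖ₑ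

/-- `z` is a discrete time perturbed trajectory of `F` corresponding to the perturbation `V`
(here `V k` is the disturbance added in step `k`, so `V 0 + ⋯ + V j` is the cumulative one). -/
def IsDiscretePerturbedTrajectory {n : ℕ}
    (F : EuclideanSpace ℝ (Fin n) → Set (EuclideanSpace ℝ (Fin n)))
    (V z : ℕ → EuclideanSpace ℝ (Fin n)) : Prop :=
  ∃ μ : ℕ → EuclideanSpace ℝ (Fin n),
    (∀ k, z (k + 1) = z k + μ k + V k) ∧ ∀ k, μ k ∈ F (z k)

/-! ### A Lyapunov function built from distances to subspaces. -/

section Lyapunov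

variable {E : Type*} [NormedAddCommGroup E]

/-! Let `‖U‖ ≤ ε` and let `w` be a multiple of `x' - U - x`. It is absolutely continuous, and its
velocity lies in the convex hull of the differences `d = μ i - μ j` with `i` active at `x'` and `j`
active at `x`. Activity gives `⟪x' - x, d⟫ ≤ 0`, so `⟪w, d⟫ ≤ 1 / 2` once `w` is scaled by a factor
of order `1 / ε`. For finitely many directions `d`, the function `max_S (‖w - P_S w‖² + a_S²)` does
not increase along those with `⟪w, d⟫ < 1` (`exists_polyhedral_lyapunov`). Hence `w` is bounded by a
constant depending only on the directions (`exists_bound_of_velocity_mem_cone`), and undoing the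
scaling gives a sensitivity constant. A discrete trajectory, held constant between integers, is a
continuous perturbed trajectory whose perturbation exceeds the sums of `V` by at most one drift step
(`isPerturbedTrajectory_embedded`). So any sensitivity constant applies to it, with `μmax` a bound
on the drifts. -/

theorem Finset.exists_pos_le_of_pos {ι : Type*} (s : Finset ι) (f : ι → ℝ) :
    ∃ κ : ℝ, 0 < κ ∧ ∀ i ∈ s, 0 < f i → κ ≤ f i := by
  classical
  induction s using Finset.induction_on with
  | empty => exact ⟨1, one_pos, by simp⟩
  | insert i s _ ih =>
    obtain ⟨κ, hκ, h⟩ := ih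
    by_cases hi : 0 < f i
    · refine ⟨min κ (f i), lt_min hκ hi, fun j hj hj' => ?_⟩
      rcases Finset.mem_insert.1 hj with rfl | hj
      · exact min_le_right _ _
      · exact (min_le_left _ _).trans (h j hj hj')
    · refine ⟨κ, hκ, fun j hj hj' => ?_⟩
      rcases Finset.mem_insert.1 hj with rfl | hj
      · exact absurd hj' hi
      · exact h j hj hj'

theorem Finset.exists_norm_le (D : Finset E) : ∃ M : ℝ, 0 < M ∧ ∀ d ∈ D, ‖d‖ ≤ M := by
  refine ⟨∑ d ∈ D, ‖d‖ + 1, by positivity, fun d hd => ?_⟩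
  have := Finset.single_le_sum (f := fun d : E => ‖d‖) (fun i _ => norm_nonneg i) hd
  linarith

variable [InnerProductSpace ℝ E] [FiniteDimensional ℝ E]

/-- The squared length of the projection onto a subspace enlarged by one vector. -/
theorem norm_sq_starProjection_span_insert (A : Set E) (d w : E)
    (hd : d ∉ Submodule.span ℝ A) :
    ‖(Submodule.span ℝ (insert d A)).starProjection w‖ ^ 2 =
      ‖(Submodule.span ℝ A).starProjection w‖ ^ 2 +
        (inner ℝ (w - (Submodule.span ℝ A).starProjection w) d /
          ‖d - (Submodule.span ℝ A).starProjection d‖) ^ 2 := by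
  set S := Submodule.span ℝ A with hS
  set e := d - S.starProjection d with he
  have hew : ∀ s ∈ S, inner ℝ (w - S.starProjection w) s = 0 :=
    fun s hs => S.starProjection_inner_eq_zero w s hs
  have hed : ∀ s ∈ S, inner ℝ e s = 0 := fun s hs => S.starProjection_inner_eq_zero d s hs
  have hPd : S.starProjection d ∈ S := S.starProjection_apply_mem d
  have hPw : S.starProjection w ∈ S := S.starProjection_apply_mem w
  have he0 : e ≠ 0 := by
    intro h
    apply hd
    rw [sub_eq_zero.1 h]
    exact hPd
  have hne : ‖e‖ ≠ 0 := norm_ne_zero_iff.2 he0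
  have hde : d = S.starProjection d + e := by rw [he]; abel
  set r := inner ℝ (w - S.starProjection w) d with hr
  have hre : inner ℝ (w - S.starProjection w) e = r := by
    rw [hr, he, inner_sub_right, hew _ hPd, sub_zero]
  have hT : S ≤ Submodule.span ℝ (insert d A) := Submodule.span_mono (Set.subset_insert _ _)
  have hdT : d ∈ Submodule.span ℝ (insert d A) := Submodule.subset_span (Set.mem_insert _ _)
  have key : (Submodule.span ℝ (insert d A)).starProjection w =
      S.starProjection w + (r / ‖e‖ ^ 2) • e := by
    symm
    refine (Submodule.eq_starProjection_of_mem_of_inner_eq_zero ?_ ?_).symm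
    · exact add_mem (hT hPw) (Submodule.smul_mem _ _ (sub_mem hdT (hT hPd)))
    · intro u hu
      obtain ⟨c, s, hs, rfl⟩ := Submodule.mem_span_insert.1 hu
      have hs0 : inner ℝ (w - (S.starProjection w + (r / ‖e‖ ^ 2) • e)) s = 0 := by
        rw [← sub_sub, inner_sub_left, hew s hs, inner_smul_left, hed s hs]; simp
      have hd0 : inner ℝ (w - (S.starProjection w + (r / ‖e‖ ^ 2) • e)) d = 0 := by
        have hee : inner ℝ e d = ‖e‖ ^ 2 := by
          conv_lhs => rw [hde]
          rw [inner_add_right, hed _ hPd, zero_add, real_inner_self_eq_norm_sq]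
        rw [← sub_sub, inner_sub_left, ← hr, inner_smul_left, hee]
        simp [hne]
      rw [inner_add_right, inner_smul_right, hs0, hd0]; simp
  rw [key, norm_add_sq_real, inner_smul_right, real_inner_comm, hed _ hPw, norm_smul,
    Real.norm_eq_abs, mul_pow, sq_abs]
  field_simp
  ring

/-- Rapidly growing radii. -/
theorem exists_radii (M κ : ℝ) :
    ∃ α : ℕ → ℝ, α 0 = 0 ∧ (∀ k, 0 ≤ α k) ∧ Monotone α ∧
      ∀ k, α k ^ 2 + ((M * α k + 1) / κ) ^ 2 ≤ α (k + 1) ^ 2 := by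
  let α : ℕ → ℝ := fun k => Nat.rec 0 (fun _ a => √(a ^ 2 + ((M * a + 1) / κ) ^ 2)) k
  have hs : ∀ k, α (k + 1) = √(α k ^ 2 + ((M * α k + 1) / κ) ^ 2) := fun k => rfl
  have h0 : ∀ k, 0 ≤ α k := by
    intro k
    cases k with
    | zero => exact le_rfl
    | succ k => rw [hs]; exact Real.sqrt_nonneg _
  refine ⟨α, rfl, h0, monotone_nat_of_le_succ fun k => ?_, fun k => ?_⟩
  · rw [hs]
    exact Real.le_sqrt_of_sq_le (by linarith [sq_nonneg ((M * α k + 1) / κ)])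
  · rw [hs, Real.sq_sqrt (by positivity)]

/-- For every finite set `D` of vectors there is a finite family of subspaces `S` with radii
`a S` such that the function `w ↦ max_S (‖w - P_S w‖² + a_S²)` does not increase at `w` in the
directions `d ∈ D` with `⟪w, d⟫ < 1`. -/
theorem exists_polyhedral_lyapunov (D : Finset E) :
    ∃ (𝒮 : Finset (Submodule ℝ E)) (a : Submodule ℝ E → ℝ), ⊥ ∈ 𝒮 ∧
      ∀ w : E, ∀ S ∈ 𝒮,
        (∀ T ∈ 𝒮, a T ^ 2 - ‖T.starProjection w‖ ^ 2 ≤ a S ^ 2 - ‖S.starProjection w‖ ^ 2) →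
        ∀ d ∈ D, inner ℝ w d < 1 → inner ℝ (w - S.starProjection w) d ≤ 0 := by
  classical
  -- This finite family is closed under adjoining a direction of `D`.
  set 𝒮 : Finset (Submodule ℝ E) :=
    D.powerset.image (fun A : Finset E => Submodule.span ℝ (A : Set E)) with h𝒮
  obtain ⟨M, hM, hDM⟩ := D.exists_norm_le
  -- `κ` bounds from below every nonzero distance from a `d ∈ D` to a subspace of the family.
  obtain ⟨κ, hκ, hle⟩ := (𝒮 ×ˢ D).exists_pos_le_of_pos (fun p => ‖p.2 - p.1.starProjection p.2‖)
  obtain ⟨α, hα0, hα, hmono, hrec⟩ := exists_radii M κ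
  have hbot : (⊥ : Submodule ℝ E) ∈ 𝒮 :=
    Finset.mem_image.2 ⟨∅, by simp, by simp⟩
  refine ⟨𝒮, fun S => α (Module.finrank ℝ S), hbot, fun w S hS hmax d hd hwd => ?_⟩
  by_contra! hpos
  obtain ⟨A, hA, rfl⟩ := Finset.mem_image.1 hS
  set S := Submodule.span ℝ (A : Set E) with hSdef
  have hdS : d ∉ S := fun h => hpos.ne' (S.starProjection_inner_eq_zero w d h)
  -- Maximality against `⊥`, whose radius is `0`.
  have hPS : ‖S.starProjection w‖ ≤ α (Module.finrank ℝ S) := by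
    have := hmax ⊥ hbot
    simp only [finrank_bot, hα0, Submodule.starProjection_bot] at this
    simp only [zero_apply, norm_zero, sub_self] at this
    exact abs_le_of_sq_le_sq' (by linarith) (hα _) |>.2
  have hTmem : Submodule.span ℝ (insert d (A : Set E)) ∈ 𝒮 :=
    Finset.mem_image.2 ⟨insert d A, by
      rw [Finset.mem_powerset] at hA ⊢
      exact Finset.insert_subset hd hA, by simp⟩
  have hlt : S < Submodule.span ℝ (insert d (A : Set E)) :=
    lt_of_le_of_ne (Submodule.span_mono (Set.subset_insert _ _)) fun h =>
      hdS (h ▸ Submodule.subset_span (Set.mem_insert _ _))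
  have hrank : Module.finrank ℝ S + 1 ≤
      Module.finrank ℝ (Submodule.span ℝ (insert d (A : Set E))) :=
    Submodule.finrank_lt_finrank_of_lt hlt
  -- Maximality against `S` enlarged by `d`: the growth of the radii forces `⟪w - P_S w, d⟫ ≥ M * α
  -- k + 1`, whereas `⟪w, d⟫ < 1` and `hPS` make it smaller.
  have hT := hmax _ hTmem
  rw [norm_sq_starProjection_span_insert _ d w hdS] at hT
  have hαT : α (Module.finrank ℝ S + 1) ^ 2 ≤
      α (Module.finrank ℝ (Submodule.span ℝ (insert d (A : Set E)))) ^ 2 :=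
    pow_le_pow_left₀ (hα _) (hmono hrank) 2
  have hepos : 0 < ‖d - S.starProjection d‖ := by
    refine norm_pos_iff.2 fun h => hdS ?_
    rw [sub_eq_zero.1 h]
    exact S.starProjection_apply_mem d
  have hκe : κ ≤ ‖d - S.starProjection d‖ := hle (S, d) (Finset.mk_mem_product hS hd) hepos
  have hk := hrec (Module.finrank ℝ S)
  set k := Module.finrank ℝ S
  have hsq : ((M * α k + 1) / κ) ^ 2 ≤
      (inner ℝ (w - S.starProjection w) d / ‖d - S.starProjection d‖) ^ 2 := by
    linarith
  have hle1 := (abs_le_of_sq_le_sq' hsq (by positivity)).2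
  have hle2 : inner ℝ (w - S.starProjection w) d / ‖d - S.starProjection d‖ ≤
      inner ℝ (w - S.starProjection w) d / κ :=
    div_le_div_of_nonneg_left hpos.le hκ hκe
  have hle3 : M * α k + 1 ≤ inner ℝ (w - S.starProjection w) d :=
    (div_le_div_iff_of_pos_right hκ).1 (hle1.trans hle2)
  have hPd : |inner ℝ (S.starProjection w) d| ≤ α k * M :=
    (abs_real_inner_le_norm _ _).trans
      (mul_le_mul hPS (hDM d hd) (norm_nonneg _) (hα _))
  have := (abs_le.1 hPd).1
  rw [inner_sub_left] at hle3
  linarith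

/-- An absolutely continuous curve `w` starting at `0` whose velocity lies in the cone spanned by
the `d ∈ D` with `⟪w, d⟫ ≤ 1 / 2` is bounded by a constant depending on `D` only. -/
theorem exists_bound_of_velocity_mem_cone (D : Finset E) :
    ∃ C : ℝ, 0 ≤ C ∧ ∀ (T K : ℝ) (w ζ : ℝ → E), 0 ≤ T → w 0 = 0 →
      (∀ s t, 0 ≤ s → s ≤ t → t ≤ T → IntervalIntegrable ζ MeasureTheory.volume s t ∧
        w t - w s = ∫ τ in s..t, ζ τ) →
      (∀ τ, 0 ≤ τ → τ ≤ T → ‖ζ τ‖ ≤ K) →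
      (∀ τ, 0 ≤ τ → τ ≤ T → ∀ q : E, (∀ d ∈ D, inner ℝ (w τ) d ≤ 1 / 2 → inner ℝ q d ≤ 0) →
        inner ℝ q (ζ τ) ≤ 0) →
      ‖w T‖ ≤ C := by
  obtain ⟨𝒮, a, hbot, hlyap⟩ := exists_polyhedral_lyapunov D
  obtain ⟨M, hM, hDM⟩ := D.exists_norm_le
  set R := ∑ S ∈ 𝒮, a S ^ 2 with hR
  refine ⟨√R, Real.sqrt_nonneg _, fun T K w ζ hT hw0 hint hK hcone => ?_⟩
  have : CompleteSpace E := FiniteDimensional.complete ℝ E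
  have hK0 : 0 ≤ K := (norm_nonneg _).trans (hK 0 le_rfl hT)
  have hnorm : ∀ (S : Submodule ℝ E) (v : E),
      ‖v - S.starProjection v‖ ^ 2 = ‖v‖ ^ 2 - ‖S.starProjection v‖ ^ 2 := by
    intro S v
    have h1 := S.starProjection_inner_eq_zero v _ (S.starProjection_apply_mem v)
    have h2 : v = (v - S.starProjection v) + S.starProjection v := by abel
    have h3 : ‖v‖ ^ 2 = ‖(v - S.starProjection v) + S.starProjection v‖ ^ 2 := by rw [← h2]
    rw [norm_add_sq_real, h1] at h3
    linarith
  -- Within time `h`, each `⟪w, d⟫` changes by less than the gap between `1 / 2` and `1`. Only the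
  -- step length depends on `K`, not the final bound.
  set h : ℝ := 1 / (4 * (K * M + 1)) with hh
  have hhpos : 0 < h := by positivity
  have hKMh : K * h * M < 1 / 2 := by
    rw [hh, mul_one_div, div_mul_eq_mul_div, div_lt_div_iff₀ (by positivity) two_pos]
    nlinarith [mul_nonneg hK0 hM.le]
  have step : ∀ s t, 0 ≤ s → s ≤ t → t ≤ T → t ≤ s + h →
      (∀ S ∈ 𝒮, ‖w s - S.starProjection (w s)‖ ^ 2 + a S ^ 2 ≤ R) →
      ∀ S ∈ 𝒮, ‖w t - S.starProjection (w t)‖ ^ 2 + a S ^ 2 ≤ R := by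
    intro s t hs hst htT hth hbound
    -- The maximizer is taken at the final time `t`: every direction allowed at some `τ` in the step
    -- still satisfies `⟪w t, d⟫ < 1`.
    obtain ⟨S, hS, hmax⟩ := 𝒮.exists_max_image
      (fun S => a S ^ 2 - ‖S.starProjection (w t)‖ ^ 2) ⟨⊥, hbot⟩
    have hact := hlyap (w t) S hS hmax
    set q := w t - S.starProjection (w t) with hq
    have hle : inner ℝ q (w t - w s) ≤ 0 := by
      obtain ⟨hi, he⟩ := hint s t hs hst htT
      rw [he, intervalIntegral.integral_of_le hst, ← integral_inner hi.1,
        ← intervalIntegral.integral_of_le hst, ← neg_nonneg, ← intervalIntegral.integral_neg]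
      refine intervalIntegral.integral_nonneg hst fun τ hτ => neg_nonneg.2 ?_
      refine hcone τ (hs.trans hτ.1) (hτ.2.trans htT) q fun d hd hwd => hact d hd ?_
      have hdist : ‖w t - w τ‖ ≤ K * h := by
        rw [(hint τ t (hs.trans hτ.1) hτ.2 htT).2]
        refine (intervalIntegral.norm_integral_le_of_norm_le_const (C := K) fun σ hσ => ?_).trans ?_
        · rw [Set.uIoc_of_le hτ.2] at hσ
          exact hK σ ((hs.trans hτ.1).trans hσ.1.le) (hσ.2.trans htT)
        · rw [abs_of_nonneg (by linarith [hτ.2])]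
          exact mul_le_mul_of_nonneg_left (by linarith [hτ.1]) hK0
      have h1 : inner ℝ (w t - w τ) d ≤ K * h * M :=
        (real_inner_le_norm _ _).trans
          (mul_le_mul hdist (hDM d hd) (norm_nonneg _) (by positivity))
      rw [inner_sub_left] at h1
      linarith
    -- Since `q` is orthogonal to `S`, the right side is at least `‖q‖² - 2⟪q, w t - w s⟫`.
    have hdec : ‖q‖ ^ 2 ≤ ‖w s - S.starProjection (w s)‖ ^ 2 := by
      have hsplit : w s - S.starProjection (w s) =
          q - ((w t - w s) - S.starProjection (w t - w s)) := by
        rw [hq, map_sub]; abel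
      have hperp : inner ℝ q (S.starProjection (w t - w s)) = 0 :=
        S.starProjection_inner_eq_zero (w t) _ (S.starProjection_apply_mem _)
      rw [hsplit, norm_sub_sq_real q, inner_sub_right, hperp]
      nlinarith [sq_nonneg ‖(w t - w s) - S.starProjection (w t - w s)‖]
    intro S' hS'
    have h1 := hmax S' hS'
    have h2 := hbound S hS
    have h3 := hnorm S (w t)
    rw [hnorm S']
    rw [← hq] at h3
    linarith
  have iter : ∀ (N : ℕ) (t : ℝ), 0 ≤ t → t ≤ T → t ≤ N * h →
      ∀ S ∈ 𝒮, ‖w t - S.starProjection (w t)‖ ^ 2 + a S ^ 2 ≤ R := by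
    intro N
    induction N with
    | zero =>
      intro t ht _ htN S hS
      have : t = 0 := le_antisymm (by simpa using htN) ht
      rw [this, hw0, map_zero, sub_zero, norm_zero]
      have := Finset.single_le_sum (f := fun S => a S ^ 2) (fun S _ => sq_nonneg (a S)) hS
      simpa using this
    | succ N ih =>
      intro t ht htT htN
      push_cast at htN
      refine step (max 0 (t - h)) t (le_max_left _ _) (max_le ht (by linarith)) htT
        (by linarith [le_max_right 0 (t - h)]) ?_
      exact ih _ (le_max_left _ _) (max_le hT (by linarith))
        (max_le (by positivity) (by linarith))
  obtain ⟨N, hN⟩ := exists_nat_ge (T / h)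
  have hfin := iter N T hT le_rfl ((div_le_iff₀ hhpos).1 hN) ⊥ hbot
  rw [Submodule.starProjection_bot, zero_apply, sub_zero] at hfin
  exact Real.le_sqrt_of_sq_le (by linarith [sq_nonneg (a ⊥)])

end Lyapunov

/-! ### Drifts of an FPCS system and its sensitivity constant. -/

section Drift

open Filter Topology

variable {n : ℕ}

/-- The support function of the drift set is the maximum over the active pieces. -/
theorem exists_active_inner_le {m : ℕ} {μ : Fin (m + 1) → EuclideanSpace ℝ (Fin n)}
    {b : Fin (m + 1) → ℝ} {x v : EuclideanSpace ℝ (Fin n)}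
    (hv : -v ∈ subdifferentialAt
      (fun y => Finset.univ.sup' Finset.univ_nonempty (fun i => -inner ℝ (μ i) y + b i)) x)
    (q : EuclideanSpace ℝ (Fin n)) :
    ∃ i, (∀ j, -inner ℝ (μ j) x + b j ≤ -inner ℝ (μ i) x + b i) ∧
      inner ℝ q v ≤ inner ℝ q (μ i) := by
  set Φ : EuclideanSpace ℝ (Fin n) → ℝ :=
    fun y => Finset.univ.sup' Finset.univ_nonempty (fun i => -inner ℝ (μ i) y + b i) with hΦ
  have hleΦ : ∀ i y, -inner ℝ (μ i) y + b i ≤ Φ y := fun i y =>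
    Finset.le_sup' (fun i => -inner ℝ (μ i) y + b i) (Finset.mem_univ i)
  -- For small `s`, pieces inactive at `x` stay below the subgradient bound at `x - s • q`, so a
  -- piece attaining the maximum there is active at `x`.
  have hev : ∀ i, ∀ᶠ s : ℝ in 𝓝[>] 0, -inner ℝ (μ i) x + b i < Φ x →
      -inner ℝ (μ i) (x - s • q) + b i < Φ x + s * inner ℝ q v := by
    intro i
    by_cases hi : -inner ℝ (μ i) x + b i < Φ x
    · have hc1 : Continuous fun s : ℝ => -inner ℝ (μ i) (x - s • q) + b i := by fun_prop
      have hc2 : Continuous fun s : ℝ => Φ x + s * inner ℝ q v := by fun_prop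
      have : ∀ᶠ s : ℝ in 𝓝 0, -inner ℝ (μ i) (x - s • q) + b i < Φ x + s * inner ℝ q v :=
        hc1.continuousAt.eventually_lt hc2.continuousAt (by simpa using hi)
      filter_upwards [nhdsWithin_le_nhds this] with s hs _ using hs
    · exact Eventually.of_forall fun s h => absurd h hi
  obtain ⟨s, hs, hs0⟩ := ((eventually_all.2 hev).and self_mem_nhdsWithin).exists
  have hs0 : 0 < s := hs0
  obtain ⟨i, -, hi⟩ := Finset.exists_mem_eq_sup' (Finset.univ_nonempty (α := Fin (m + 1)))
    (fun i => -inner ℝ (μ i) (x - s • q) + b i)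
  have hsub := hv (x - s • q)
  have hin : inner ℝ (-v) (x - s • q - x) = s * inner ℝ q v := by
    rw [sub_sub_cancel_left, inner_neg_neg, inner_smul_right, real_inner_comm]
  rw [hin] at hsub
  have hval : Φ x + s * inner ℝ q v ≤ -inner ℝ (μ i) (x - s • q) + b i := by
    rw [← hi]; exact hsub
  have hact : Φ x ≤ -inner ℝ (μ i) x + b i := by
    by_contra! h
    exact absurd (hs i h) (not_lt.2 hval)
  refine ⟨i, fun j => (hleΦ j x).trans hact, ?_⟩
  have h1 := hleΦ i x
  rw [inner_sub_right, inner_smul_right, real_inner_comm q] at hval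
  have : s * inner ℝ q v ≤ s * inner ℝ q (μ i) := by linarith
  exact le_of_mul_le_mul_left this hs0

/-- Testing a drift `v` against `q = v` gives `‖v‖² ≤ ⟪v, μ i⟫` for some `i`. -/
theorem IsFPCS.exists_norm_le {F : EuclideanSpace ℝ (Fin n) → Set (EuclideanSpace ℝ (Fin n))}
    (hF : IsFPCS F) : ∃ L : ℝ, 0 ≤ L ∧ ∀ x, ∀ v ∈ F x, ‖v‖ ≤ L := by
  obtain ⟨m, μ, b, hF⟩ := hF
  refine ⟨∑ i, ‖μ i‖, by positivity, fun x v hv => ?_⟩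
  rw [hF] at hv
  obtain ⟨i, -, hi⟩ := exists_active_inner_le hv v
  rw [real_inner_self_eq_norm_sq] at hi
  have h1 := hi.trans (real_inner_le_norm _ _)
  have h2 : ‖μ i‖ ≤ ∑ i, ‖μ i‖ :=
    Finset.single_le_sum (f := fun i => ‖μ i‖) (fun _ _ => norm_nonneg _) (Finset.mem_univ i)
  refine le_trans ?_ h2
  rcases (norm_nonneg v).eq_or_lt with h0 | h0
  · rw [← h0]; exact norm_nonneg _
  · rw [pow_two] at h1
    exact le_of_mul_le_mul_left h1 h0

theorem intervalIntegrable_of_integrableOn_Icc {E : Type*} [NormedAddCommGroup E] {ξ : ℝ → E}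
    (h : ∀ t, 0 ≤ t → MeasureTheory.IntegrableOn ξ (Set.Icc 0 t)) {s t : ℝ} (hs : 0 ≤ s)
    (ht : 0 ≤ t) : IntervalIntegrable ξ MeasureTheory.volume s t := by
  refine ((h (max s t) (hs.trans (le_max_left _ _))).mono_set ?_).intervalIntegrable
  exact fun r hr => ⟨(le_min hs ht).trans hr.1, hr.2⟩

/-- Perturbed trajectories stay within a constant multiple of any positive bound for the
perturbation. -/
theorem IsFPCS.exists_norm_sub_le
    {F : EuclideanSpace ℝ (Fin n) → Set (EuclideanSpace ℝ (Fin n))} (hF : IsFPCS F) :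
    ∃ C : ℝ, 0 < C ∧ ∀ x U x' : ℝ → EuclideanSpace ℝ (Fin n),
      IsUnperturbedTrajectory F x → IsPerturbedTrajectory F U x' → x' 0 = x 0 →
      ∀ T, 0 ≤ T → ∀ ε, 0 < ε → (∀ τ, 0 ≤ τ → τ ≤ T → ‖U τ‖ ≤ ε) → ‖x' T - x T‖ ≤ C * ε := by
  classical
  obtain ⟨L, hL0, hL⟩ := hF.exists_norm_le
  obtain ⟨m, μ, b, hF⟩ := hF
  set D : Finset (EuclideanSpace ℝ (Fin n)) :=
    Finset.univ.image (fun p : Fin (m + 1) × Fin (m + 1) => μ p.1 - μ p.2) with hD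
  obtain ⟨M, hM, hDM⟩ := D.exists_norm_le
  obtain ⟨C, hC, hbound⟩ := exists_bound_of_velocity_mem_cone D
  -- `2 * M` undoes the scaling by `ρ`; the `1` pays for `U T`.
  refine ⟨2 * M * C + 1, by positivity, fun x U x' hx hx' h0 T hT ε hε hU => ?_⟩
  obtain ⟨η, hη, hxη, hηF⟩ := hx.drift
  obtain ⟨ξ, hξ, hxξ, hξF⟩ := hx'.drift
  set ρ : ℝ := (2 * M * ε)⁻¹ with hρ
  have hρ0 : 0 < ρ := by positivity
  have hw := hbound T (ρ * (L + L)) (fun t => ρ • (x' t - U t - x t))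
    (fun t => ρ • (ξ t - η t)) hT (by simp [hx'.zero, h0]) ?_ ?_ ?_
  · rw [norm_smul, Real.norm_of_nonneg hρ0.le, hρ, inv_mul_le_iff₀ (by positivity)] at hw
    have h1 : x' T - x T = (x' T - U T - x T) + U T := by abel
    rw [h1]
    refine (norm_add_le _ _).trans ?_
    have := hU T hT le_rfl
    linarith
  · intro s t hs hst _
    have ht := hs.trans hst
    have hξi := intervalIntegrable_of_integrableOn_Icc hξ hs ht
    have hηi := intervalIntegrable_of_integrableOn_Icc hη hs ht
    refine ⟨(hξi.sub hηi).smul ρ, ?_⟩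
    rw [intervalIntegral.integral_smul, intervalIntegral.integral_sub hξi hηi, ← smul_sub,
      ← intervalIntegral.integral_interval_sub_left
        (intervalIntegrable_of_integrableOn_Icc hξ le_rfl ht)
        (intervalIntegrable_of_integrableOn_Icc hξ le_rfl hs),
      ← intervalIntegral.integral_interval_sub_left
        (intervalIntegrable_of_integrableOn_Icc hη le_rfl ht)
        (intervalIntegrable_of_integrableOn_Icc hη le_rfl hs),
      hxξ t ht, hxξ s hs, hxη t ht, hxη s hs]
    congr 1
    abel
  · intro τ hτ _
    rw [norm_smul, Real.norm_of_nonneg hρ0.le]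
    exact mul_le_mul_of_nonneg_left ((norm_sub_le _ _).trans
      (add_le_add (hL _ _ (hξF τ hτ)) (hL _ _ (hηF τ hτ)))) hρ0.le
  · intro τ hτ hτT q hq
    have h1 := hξF τ hτ
    have h2 := hηF τ hτ
    rw [hF] at h1 h2
    obtain ⟨i, hi, hiq⟩ := exists_active_inner_le h1 q
    -- The direction `-q` yields the lower bound `⟪q, μ j⟫ ≤ ⟪q, η τ⟫`.
    obtain ⟨j, hj, hjq⟩ := exists_active_inner_le h2 (-q)
    rw [inner_neg_left, inner_neg_left] at hjq
    have hdD : μ i - μ j ∈ D := Finset.mem_image.2 ⟨(i, j), Finset.mem_univ _, rfl⟩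
    have hd := hq (μ i - μ j) hdD ?_
    · rw [inner_sub_right] at hd
      rw [inner_smul_right, inner_sub_right]
      exact mul_nonpos_of_nonneg_of_nonpos hρ0.le (by linarith)
    · have hU' : |inner ℝ (U τ) (μ i - μ j)| ≤ ε * M :=
        (abs_real_inner_le_norm _ _).trans
          (mul_le_mul (hU τ hτ hτT) (hDM _ hdD) (norm_nonneg _) hε.le)
      have h3 := (abs_le.1 hU').1
      -- `h4` and `h5` add up to `⟪x' τ - x τ, μ i - μ j⟫ ≤ 0`, the monotonicity of the
      -- subdifferential.
      have h4 := hi j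
      have h5 := hj i
      rw [inner_smul_left]
      have h6 : inner ℝ (x' τ - U τ - x τ) (μ i - μ j) ≤ ε * M := by
        simp only [inner_sub_left, inner_sub_right, real_inner_comm (x' τ),
          real_inner_comm (x τ)] at h3 h4 h5 ⊢
        linarith
      have h7 : ρ * (ε * M) = 1 / 2 := by rw [hρ]; field_simp
      simp only [conj_trivial]
      rw [← h7]
      exact mul_le_mul_of_nonneg_left h6 hρ0.le

theorem IsFPCS.exists_isSensitivityConstant
    {F : EuclideanSpace ℝ (Fin n) → Set (EuclideanSpace ℝ (Fin n))} (hF : IsFPCS F) :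
    ∃ C : ℝ, IsSensitivityConstant F C := by
  obtain ⟨C, hC, h⟩ := hF.exists_norm_sub_le
  refine ⟨C, hC, fun x U x' hx hx' h0 T hT => ?_⟩
  set σ := ⨆ τ ∈ Set.Icc (0 : ℝ) T, ‖U τ‖ₑ with hσ
  rcases eq_or_ne σ ⊤ with htop | htop
  · rw [htop, ENNReal.mul_top (by simpa using hC)]
    exact le_top
  · have hUσ : ∀ τ, 0 ≤ τ → τ ≤ T → ‖U τ‖ ≤ σ.toReal := fun τ h1 h2 => by
      rw [← toReal_enorm]
      exact ENNReal.toReal_mono htop (le_iSup₂ (f := fun τ _ => ‖U τ‖ₑ) τ ⟨h1, h2⟩)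
    have hle : ‖x' T - x T‖ ≤ C * σ.toReal := by
      -- The supremum may be `0`, whereas `h` needs a positive bound.
      refine le_of_forall_pos_le_add fun δ hδ => ?_
      have := h x U x' hx hx' h0 T hT (σ.toReal + δ / C)
        (add_pos_of_nonneg_of_pos ENNReal.toReal_nonneg (by positivity))
        fun τ h1 h2 => (hUσ τ h1 h2).trans (le_add_of_nonneg_right (by positivity))
      rwa [mul_add, mul_div_cancel₀ _ hC.ne'] at this
    rw [← ofReal_norm, ← ENNReal.ofReal_toReal htop, ← ENNReal.ofReal_mul hC.le]
    exact ENNReal.ofReal_le_ofReal hle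

end Drift

/-! ### Embedding discrete trajectories into continuous time. -/

section Discrete

open Filter Topology MeasureTheory

variable {E : Type*} [NormedAddCommGroup E]

theorem eventually_natFloor_eq {t : ℝ} (ht : 0 ≤ t) :
    ∀ᶠ s in 𝓝[≥] t, ⌊s⌋₊ = ⌊t⌋₊ := by
  filter_upwards [self_mem_nhdsWithin, nhdsWithin_le_nhds (Iio_mem_nhds (Nat.lt_floor_add_one t))]
    with s hs hs'
  exact (Nat.floor_eq_iff (ht.trans hs)).2 ⟨(Nat.floor_le ht).trans hs, hs'⟩

theorem integrableOn_comp_natFloor (u : ℕ → E) (t : ℝ) :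
    IntegrableOn (fun τ : ℝ => u ⌊τ⌋₊) (Set.Icc 0 t) := by
  have hm : StronglyMeasurable (fun τ : ℝ => u ⌊τ⌋₊) :=
    (StronglyMeasurable.of_discrete (f := u)).comp_measurable Nat.measurable_floor
  refine Measure.integrableOn_of_bounded (M := ∑ i ∈ Finset.range (⌊t⌋₊ + 1), ‖u i‖)
    (by simp) hm.aestronglyMeasurable ?_
  refine (ae_restrict_mem measurableSet_Icc).mono fun τ hτ => ?_
  exact Finset.single_le_sum (f := fun i => ‖u i‖) (fun _ _ => norm_nonneg _)
    (Finset.mem_range.2 (Nat.lt_succ_of_le (Nat.floor_le_floor hτ.2)))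

variable [NormedSpace ℝ E]

theorem integral_comp_natFloor_of_le [CompleteSpace E] (u : ℕ → E) (k : ℕ) {t : ℝ} (hkt : k ≤ t) (htk : t ≤ k + 1) :
    ∫ τ in (k : ℝ)..t, u ⌊τ⌋₊ = (t - k) • u k := by
  -- On `Ico` the floor is exactly `k`; on `Ioc` it fails at the endpoint when `t = k + 1`.
  rw [← intervalIntegral.integral_const, intervalIntegral.integral_of_le hkt,
    intervalIntegral.integral_of_le hkt, ← integral_Ico_eq_integral_Ioc,
    ← integral_Ico_eq_integral_Ioc]
  refine setIntegral_congr_fun measurableSet_Ico fun τ hτ => ?_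
  have : ⌊τ⌋₊ = k :=
    (Nat.floor_eq_iff ((Nat.cast_nonneg k).trans hτ.1)).2 ⟨hτ.1, hτ.2.trans_le htk⟩
  simp only [this]

theorem integral_comp_natFloor [CompleteSpace E] (u : ℕ → E) {t : ℝ} (ht : 0 ≤ t) :
    ∫ τ in (0 : ℝ)..t, u ⌊τ⌋₊ =
      ∑ i ∈ Finset.range ⌊t⌋₊, u i + (t - ⌊t⌋₊) • u ⌊t⌋₊ := by
  have hi : ∀ {a b : ℝ}, 0 ≤ a → 0 ≤ b →
      IntervalIntegrable (fun τ : ℝ => u ⌊τ⌋₊) volume a b := fun ha hb =>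
    intervalIntegrable_of_integrableOn_Icc (fun t _ => integrableOn_comp_natFloor u t) ha hb
  have hN : ∀ N : ℕ, ∫ τ in (0 : ℝ)..N, u ⌊τ⌋₊ = ∑ i ∈ Finset.range N, u i := by
    intro N
    induction N with
    | zero => simp
    | succ N ih =>
      rw [Finset.sum_range_succ, ← ih, ← intervalIntegral.integral_add_adjacent_intervals
        (hi le_rfl (Nat.cast_nonneg N)) (hi (Nat.cast_nonneg N) (Nat.cast_nonneg _)),
        integral_comp_natFloor_of_le u N (by simp) (by simp)]
      simp
  rw [← intervalIntegral.integral_add_adjacent_intervals (hi le_rfl (Nat.cast_nonneg ⌊t⌋₊))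
    (hi (Nat.cast_nonneg _) ht), hN, integral_comp_natFloor_of_le u _ (Nat.floor_le ht)
    (Nat.lt_floor_add_one t).le]

/-- The cumulative continuous-time perturbation that embeds a discrete trajectory. -/
noncomputable def embeddedPerturbation (V μ : ℕ → E) (t : ℝ) : E :=
  ∑ i ∈ Finset.range ⌊t⌋₊, V i - (t - ⌊t⌋₊) • μ ⌊t⌋₊

/-- Between integers the perturbation cancels the drift, so the state stays at `z ⌊t⌋₊`. At the next
integer the cancellation is released and `V` is added, which produces the discrete step. -/
theorem isPerturbedTrajectory_embedded {n : ℕ}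
    {F : EuclideanSpace ℝ (Fin n) → Set (EuclideanSpace ℝ (Fin n))}
    {V μ z : ℕ → EuclideanSpace ℝ (Fin n)} (hz : ∀ k, z (k + 1) = z k + μ k + V k)
    (hμ : ∀ k, μ k ∈ F (z k)) :
    IsPerturbedTrajectory F (embeddedPerturbation V μ) (fun t => z ⌊t⌋₊) where
  rightContinuous t ht := by
    have hc : Continuous fun s : ℝ =>
        ∑ i ∈ Finset.range ⌊t⌋₊, V i - (s - (⌊t⌋₊ : ℝ)) • μ ⌊t⌋₊ := by fun_prop
    refine hc.continuousWithinAt.congr_of_eventuallyEq ?_ rfl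
    filter_upwards [eventually_natFloor_eq ht] with s hs
    rw [embeddedPerturbation, hs]
  zero := by simp [embeddedPerturbation]
  integrable t _ := integrableOn_comp_natFloor z t
  drift := by
    refine ⟨fun t => μ ⌊t⌋₊, fun t _ => integrableOn_comp_natFloor μ t, fun t ht => ?_,
      fun t _ => hμ _⟩
    have hsum : ∀ N, z N = z 0 + ∑ i ∈ Finset.range N, μ i + ∑ i ∈ Finset.range N, V i := by
      intro N
      induction N with
      | zero => simp
      | succ N ih => rw [hz, ih, Finset.sum_range_succ, Finset.sum_range_succ]; abel
    rw [integral_comp_natFloor μ ht, embeddedPerturbation, hsum ⌊t⌋₊, Nat.floor_zero]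
    abel

theorem norm_embeddedPerturbation_le {V μ : ℕ → E} {L : ℝ} (hL : ∀ k, ‖μ k‖ ≤ L) (k : ℕ) {t : ℝ}
    (ht : 0 ≤ t) (htk : t ≤ k) :
    ‖embeddedPerturbation V μ t‖ ≤
      L + ⨆ j : Fin k, ‖∑ i ∈ Finset.range ((j : ℕ) + 1), V i‖ := by
  have hV : ‖∑ i ∈ Finset.range ⌊t⌋₊, V i‖ ≤
      ⨆ j : Fin k, ‖∑ i ∈ Finset.range ((j : ℕ) + 1), V i‖ := by
    have hle : ⌊t⌋₊ ≤ k := Nat.floor_le_of_le htk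
    -- The empty sum is no term of the supremum, but the supremum is nonnegative, also for `k = 0`.
    -- A sum of `N + 1` terms is the term `j = N`.
    rcases h : ⌊t⌋₊ with _ | N
    · simpa using Real.iSup_nonneg fun j : Fin k => norm_nonneg _
    · exact le_ciSup (f := fun j : Fin k => ‖∑ i ∈ Finset.range ((j : ℕ) + 1), V i‖)
        (Set.finite_range _).bddAbove ⟨N, by omega⟩
  have hμ : ‖(t - ⌊t⌋₊) • μ ⌊t⌋₊‖ ≤ L := by
    have h1 := Nat.floor_le ht
    have h2 := Nat.lt_floor_add_one t
    rw [norm_smul, Real.norm_of_nonneg (by linarith)]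
    exact (mul_le_of_le_one_left (norm_nonneg _) (by linarith)).trans (hL _)
  rw [embeddedPerturbation]
  linarith [norm_sub_le (∑ i ∈ Finset.range ⌊t⌋₊, V i) ((t - ⌊t⌋₊) • μ ⌊t⌋₊)]

end Discrete

/-- The maximum over `j < k` is a supremum over `Fin k`, which is `0` for `k = 0`. -/
theorem mainTheorem7 (n : ℕ)
    (F : EuclideanSpace ℝ (Fin n) → Set (EuclideanSpace ℝ (Fin n))) (hF : IsFPCS F) :
    (∃ C : ℝ, IsSensitivityConstant F C) ∧
    ∃ μmax : ℝ, 0 ≤ μmax ∧ ∀ C : ℝ, IsSensitivityConstant F C →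
      ∀ (x : ℝ → EuclideanSpace ℝ (Fin n)) (V z : ℕ → EuclideanSpace ℝ (Fin n)),
        IsUnperturbedTrajectory F x → IsDiscretePerturbedTrajectory F V z → x 0 = z 0 →
        ∀ k : ℕ, ‖x k - z k‖ ≤
          C * (μmax + ⨆ j : Fin k, ‖∑ i ∈ Finset.range ((j : ℕ) + 1), V i‖) := by
  refine ⟨hF.exists_isSensitivityConstant, ?_⟩
  obtain ⟨L, hL0, hL⟩ := hF.exists_norm_le
  refine ⟨L, hL0, fun C hC x V z hx hz h0 k => ?_⟩
  obtain ⟨μ, hz, hμ⟩ := hz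
  -- At the integer time `k` the embedded trajectory equals `z k`.
  have h := hC.2 x _ _ hx (isPerturbedTrajectory_embedded hz hμ) (by simp [h0]) k
    (Nat.cast_nonneg k)
  set B := L + ⨆ j : Fin k, ‖∑ i ∈ Finset.range ((j : ℕ) + 1), V i‖ with hB
  have hB0 : 0 ≤ B := add_nonneg hL0 (Real.iSup_nonneg fun _ => norm_nonneg _)
  have hsup : ⨆ τ ∈ Set.Icc (0 : ℝ) k, ‖embeddedPerturbation V μ τ‖ₑ ≤ ENNReal.ofReal B :=
    iSup₂_le fun τ hτ => by
      rw [← ofReal_norm]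
      exact ENNReal.ofReal_le_ofReal
        (norm_embeddedPerturbation_le (fun i => hL _ _ (hμ i)) k hτ.1 hτ.2)
  have h' := h.trans (mul_le_mul_right hsup _)
  rw [← ofReal_norm, ← ENNReal.ofReal_mul hC.1.le,
    ENNReal.ofReal_le_ofReal_iff (mul_nonneg hC.1.le hB0), Nat.floor_natCast,
    norm_sub_rev] at h'
  exact h'
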